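/- Let $H$ be a separable complex Hilbert space, let $-\infty<a<b<\infty$, and let $A_1\le 0$ and $A_2\ge 0$ be (possibly unbounded) selfadjoint operators in $H$. For an open interval $I\subseteq\mathbb R$ and a selfadjoint operator $A$ in $H$, the minimal operator generated by $\frac{d}{dt}+A$ in $L_2(H,I)$ is the closure of the operator $u\mapsto u'+Au$ defined on the finite sums $u(t)=\sum_j\varphi_j(t)f_j$ with $\varphi_j\in C_0^\infty(I)$ and $f_j\in D(A)$. Let $L_{10}$ and $L_{20}$ be the minimal operators generated by $\frac{d}{dt}+A_1$ in $L_2(H,(-\infty,a))$ and by $\frac{d}{dt}+A_2$ in $L_2(H,(b,\infty))$, and let $L_0=L_{10}\oplus L_{20}$ in $L_2(H,(-\infty,a))\oplus L_2(H,(b,\infty))$. **Theorem 3.1.** Every normal extension $\tilde L$ of $L_0$ in $L_2(H,(-\infty,a))\oplus L_2(H,(b,\infty))$ has empty point spectrum: $\sigma_p(\tilde L)=\emptyset$. Here a normal extension of $L_0$ is a densely defined closed operator $\tilde L\supseteq L_0$ with $D(\tilde L)=D(\tilde L^*)$ and $\|\tilde L f\|=\|\tilde L^*f\|$ for all $f\in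 D(\tilde L)$. -/

import Mathlib

open MeasureTheory Set
open scoped ContDiff LinearPMap

namespace NormalExt

noncomputable section

section Operators

variable {E F : Type*} [NormedAddCommGroup E] [InnerProductSpace ℂ E]
  [NormedAddCommGroup F] [InnerProductSpace ℂ F]

/-- The point spectrum (set of eigenvalues) of an unbounded operator. -/
def pointSpectrum (T : E →ₗ.[ℂ] E) : Set ℂ :=
  {z | ∃ u : T.domain, (u : E) ≠ 0 ∧ T u = z • (u : E)}

/-- `0 ≤ A` in the sense of quadratic forms (used for selfadjoint `A`). -/
def Nonneg (A : E →ₗ.[ℂ] E) : Prop :=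
  ∀ x : A.domain, 0 ≤ (inner ℂ (A x) (x : E)).re

/-- `A ≤ 0` in the sense of quadratic forms (used for selfadjoint `A`). -/
def Nonpos (A : E →ₗ.[ℂ] E) : Prop :=
  ∀ x : A.domain, (inner ℂ (A x) (x : E)).re ≤ 0

/-- A densely defined closed operator `N` is formally normal if `D(N) ⊆ D(N*)` and
`‖N f‖ = ‖N* f‖` for all `f ∈ D(N)`. -/
structure IsFormallyNormal [CompleteSpace E] (N : E →ₗ.[ℂ] E) : Prop where
  dense_domain : Dense (N.domain : Set E)
  isClosed : N.IsClosed
  domain_le : N.domain ≤ N†.domain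
  norm_eq : ∀ f : N.domain, ‖N f‖ = ‖N† ⟨f, domain_le f.2⟩‖

/-- A normal operator is a formally normal operator `N` with `D(N) = D(N*)`. -/
structure IsNormal [CompleteSpace E] (N : E →ₗ.[ℂ] E) : Prop extends IsFormallyNormal N where
  domain_eq : N.domain = N†.domain

/-- The orthogonal direct sum `S ⊕ T` of two unbounded operators, acting in the Hilbert space
direct sum `E ⊕ F`, with domain `D(S) ⊕ D(T)`. -/
def directSum (S : E →ₗ.[ℂ] E) (T : F →ₗ.[ℂ] F) : WithLp 2 (E × F) →ₗ.[ℂ] WithLp 2 (E × F) where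
  domain := (S.domain.prod T.domain).comap (WithLp.linearEquiv 2 ℂ (E × F)).toLinearMap
  toFun :=
    { toFun := fun u => WithLp.toLp 2 (S ⟨(u : WithLp 2 (E × F)).fst, u.2.1⟩,
        T ⟨(u : WithLp 2 (E × F)).snd, u.2.2⟩)
      map_add' := fun u v => by
        rw [← WithLp.toLp_add, Prod.mk_add_mk, ← LinearPMap.map_add, ← LinearPMap.map_add]
        rfl
      map_smul' := fun c u => by
        rw [RingHom.id_apply, ← WithLp.toLp_smul, Prod.smul_mk, ← LinearPMap.map_smul,
          ← LinearPMap.map_smul]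
        rfl }

end Operators

section Minimal

variable {H : Type*} [NormedAddCommGroup H] [InnerProductSpace ℂ H]

/-- The Hilbert space `L₂(H, I)` of square-integrable `H`-valued functions on `I ⊆ ℝ`. -/
abbrev L2 (H : Type*) [NormedAddCommGroup H] (I : Set ℝ) :=
  Lp H 2 ((volume : Measure ℝ).restrict I)

/-- `φ ∈ C₀^∞(I)`: smooth with compact support contained in `I`. -/
structure IsTestFunction (I : Set ℝ) (φ : ℝ → ℝ) : Prop where
  contDiff : ContDiff ℝ ∞ φ
  hasCompactSupport : HasCompactSupport φ
  tsupport_subset : tsupport φ ⊆ I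

/-- The graph of `d/dt + A` on the finite sums `∑ φ_j(t) f_j` with `φ_j ∈ C₀^∞(I)`, `f_j ∈ D(A)`:
the complex linear span of the pairs `(φ f, φ' f + φ A f)`. (The span is complex, so real-valued
`φ` give the same space as complex-valued ones.) -/
def preminimalGraph (I : Set ℝ) (A : H →ₗ.[ℂ] H) : Submodule ℂ (L2 H I × L2 H I) :=
  Submodule.span ℂ {p | ∃ φ : ℝ → ℝ, IsTestFunction I φ ∧ ∃ f : A.domain,
    (p.1 =ᵐ[volume.restrict I] fun t => (φ t : ℂ) • (f : H)) ∧
    (p.2 =ᵐ[volume.restrict I] fun t => ((deriv φ t : ℝ) : ℂ) • (f : H) + (φ t : ℂ) • A f)}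

/-- The operator `d/dt + A` in `L₂(H, I)` on the finite sums `∑ φ_j(t) f_j` with
`φ_j ∈ C₀^∞(I)`, `f_j ∈ D(A)`. -/
def preminimalOperator (I : Set ℝ) (A : H →ₗ.[ℂ] H) : L2 H I →ₗ.[ℂ] L2 H I :=
  (preminimalGraph I A).toLinearPMap

/-- The minimal operator generated by `d/dt + A` in `L₂(H, I)`. -/
def minimalOperator (I : Set ℝ) (A : H →ₗ.[ℂ] H) : L2 H I →ₗ.[ℂ] L2 H I :=
  (preminimalOperator I A).closure

/-- The minimal operator `L₀ = L₁₀ ⊕ L₂₀` generated by `(d/dt + A₁, d/dt + A₂)` in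
`L₂(H, (-∞, a)) ⊕ L₂(H, (b, ∞))`. -/
def minimalOperatorSum (a b : ℝ) (A₁ A₂ : H →ₗ.[ℂ] H) :
    WithLp 2 (L2 H (Iio a) × L2 H (Ioi b)) →ₗ.[ℂ] WithLp 2 (L2 H (Iio a) × L2 H (Ioi b)) :=
  directSum (minimalOperator (Iio a) A₁) (minimalOperator (Ioi b) A₂)

/-! The operators above are well defined: for selfadjoint `A` the span is the graph of an
operator, and this operator is closable. -/

theorem IsTestFunction.memLp {I : Set ℝ} {φ : ℝ → ℝ} (h : IsTestFunction I φ) (f : H) :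
    MemLp (fun t => (φ t : ℂ) • f) 2 ((volume : Measure ℝ).restrict I) := by
  refine Continuous.memLp_of_hasCompactSupport ?_ ?_
  · have := h.contDiff.continuous
    fun_prop
  · refine h.hasCompactSupport.mono ?_
    intro t ht
    contrapose! ht
    simp only [Function.mem_support, not_not] at ht ⊢
    simp [ht]

theorem IsTestFunction.memLp_deriv {I : Set ℝ} {φ : ℝ → ℝ} (h : IsTestFunction I φ) (f : H) :
    MemLp (fun t => ((deriv φ t : ℝ) : ℂ) • f) 2 ((volume : Measure ℝ).restrict I) := by
  refine Continuous.memLp_of_hasCompactSupport ?_ ?_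
  · have := h.contDiff.continuous_deriv (by simp)
    fun_prop
  · refine h.hasCompactSupport.deriv.mono ?_
    intro t ht
    contrapose! ht
    simp only [Function.mem_support, not_not] at ht ⊢
    simp [ht]

theorem IsTestFunction.integral_mul_deriv {I : Set ℝ} {φ ψ : ℝ → ℝ} (hφ : IsTestFunction I φ)
    (hψ : IsTestFunction I ψ) :
    ∫ t in I, ψ t * deriv φ t = - ∫ t in I, deriv ψ t * φ t := by
  have e1 : ∫ t in I, ψ t * deriv φ t = ∫ t, ψ t * deriv φ t := by
    refine setIntegral_eq_integral_of_forall_compl_eq_zero fun t ht => ?_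
    rw [image_eq_zero_of_notMem_tsupport (fun h => ht (hψ.tsupport_subset h)), zero_mul]
  have e2 : ∫ t in I, deriv ψ t * φ t = ∫ t, deriv ψ t * φ t := by
    refine setIntegral_eq_integral_of_forall_compl_eq_zero fun t ht => ?_
    rw [image_eq_zero_of_notMem_tsupport (fun h => ht (hφ.tsupport_subset h)), mul_zero]
  rw [e1, e2]
  have cφ := hφ.contDiff.continuous
  have cψ := hψ.contDiff.continuous
  have cφ' := hφ.contDiff.continuous_deriv (by simp)
  have cψ' := hψ.contDiff.continuous_deriv (by simp)
  refine integral_mul_deriv_eq_deriv_mul_of_integrable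
    (fun t _ => (hψ.contDiff.differentiable (by simp) t).hasDerivAt)
    (fun t _ => (hφ.contDiff.differentiable (by simp) t).hasDerivAt) ?_ ?_ ?_
  · exact (cψ.mul cφ').integrable_of_hasCompactSupport hψ.hasCompactSupport.mul_right
  · exact (cψ'.mul cφ).integrable_of_hasCompactSupport hφ.hasCompactSupport.mul_left
  · exact (cψ.mul cφ).integrable_of_hasCompactSupport hψ.hasCompactSupport.mul_right

/-- Integration by parts against `ψ g`, for pairs in the closure of the graph. -/
theorem inner_of_mem_closure_preminimalGraph {I : Set ℝ} {A : H →ₗ.[ℂ] H}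
    (hA : A.IsFormalAdjoint A) {p : L2 H I × L2 H I}
    (hp : p ∈ (preminimalGraph I A).topologicalClosure) {ψ : ℝ → ℝ} (hψ : IsTestFunction I ψ)
    (g : A.domain) :
    inner ℂ ((hψ.memLp (g : H)).toLp _) p.2 =
      inner ℂ ((hψ.memLp (A g)).toLp _ - (hψ.memLp_deriv (g : H)).toLp _) p.1 := by
  set w := (hψ.memLp (g : H)).toLp _ with hw
  set z := (hψ.memLp (A g)).toLp _ - (hψ.memLp_deriv (g : H)).toLp _ with hz
  have hcl : IsClosed {p : L2 H I × L2 H I | inner ℂ w p.2 = inner ℂ z p.1} :=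
    isClosed_eq (by fun_prop) (by fun_prop)
  refine closure_minimal ?_ hcl hp
  intro p hp
  simp only [SetLike.mem_coe, preminimalGraph] at hp
  induction hp using Submodule.span_induction with
  | zero => simp
  | add x y _ _ hx hy =>
    simp only [mem_ofPred_eq, Prod.snd_add, Prod.fst_add, inner_add_right] at *
    rw [hx, hy]
  | smul c x _ hx =>
    simp only [mem_ofPred_eq, Prod.smul_snd, Prod.smul_fst, inner_smul_right] at *
    rw [hx]
  | mem p hp =>
    obtain ⟨φ, hφ, f, h1, h2⟩ := hp
    have cφ := hφ.contDiff.continuous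
    have cψ := hψ.contDiff.continuous
    have cφ' := hφ.contDiff.continuous_deriv (by simp)
    have cψ' := hψ.contDiff.continuous_deriv (by simp)
    have i1 : IntegrableOn (fun t => ψ t * deriv φ t) I :=
      ((cψ.mul cφ').integrable_of_hasCompactSupport hψ.hasCompactSupport.mul_right).integrableOn
    have i2 : IntegrableOn (fun t => deriv ψ t * φ t) I :=
      ((cψ'.mul cφ).integrable_of_hasCompactSupport hφ.hasCompactSupport.mul_left).integrableOn
    have i3 : IntegrableOn (fun t => ψ t * φ t) I :=
      ((cψ.mul cφ).integrable_of_hasCompactSupport hψ.hasCompactSupport.mul_right).integrableOn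
    have hwc : w =ᵐ[volume.restrict I] fun t => (ψ t : ℂ) • (g : H) := (hψ.memLp (g : H)).coeFn_toLp
    have hzc : z =ᵐ[volume.restrict I]
        fun t => (ψ t : ℂ) • A g - ((deriv ψ t : ℝ) : ℂ) • (g : H) := by
      filter_upwards [Lp.coeFn_sub ((hψ.memLp (A g)).toLp _) ((hψ.memLp_deriv (g : H)).toLp _),
        (hψ.memLp (A g)).coeFn_toLp, (hψ.memLp_deriv (g : H)).coeFn_toLp] with t h h' h''
      rw [hz, h, Pi.sub_apply, h', h'']
    have l : inner ℂ w p.2 = ∫ t in I, (((ψ t * deriv φ t : ℝ) : ℂ) * inner ℂ (g : H) (f : H)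
        + ((ψ t * φ t : ℝ) : ℂ) * inner ℂ (g : H) (A f)) := by
      rw [L2.inner_def]
      refine integral_congr_ae ?_
      filter_upwards [hwc, h2] with t ht ht'
      rw [ht, ht']
      simp only [inner_smul_left, inner_add_right, inner_smul_right, Complex.conj_ofReal]
      push_cast
      ring
    have r : inner ℂ z p.1 = ∫ t in I, (((ψ t * φ t : ℝ) : ℂ) * inner ℂ (A g) (f : H)
        - ((deriv ψ t * φ t : ℝ) : ℂ) * inner ℂ (g : H) (f : H)) := by
      rw [L2.inner_def]
      refine integral_congr_ae ?_
      filter_upwards [hzc, h1] with t ht ht'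
      rw [ht, ht']
      simp only [inner_smul_left, inner_sub_left, inner_smul_right, Complex.conj_ofReal]
      push_cast
      ring
    change inner ℂ w p.2 = inner ℂ z p.1
    rw [l, r, integral_add (i1.ofReal.mul_const _) (i3.ofReal.mul_const _),
      integral_sub (i3.ofReal.mul_const _) (i2.ofReal.mul_const _)]
    simp only [integral_mul_const, integral_complex_ofReal]
    rw [hφ.integral_mul_deriv hψ, hA g f]
    push_cast
    ring

theorem eq_zero_of_inner_test_eq_zero [CompleteSpace H] {I : Set ℝ} (hI : IsOpen I)
    {D : Submodule ℂ H} (hD : Dense (D : Set H)) (v : L2 H I)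
    (h : ∀ (ψ : ℝ → ℝ) (hψ : IsTestFunction I ψ) (g : D),
      inner ℂ ((hψ.memLp (g : H)).toLp _) v = 0) : v = 0 := by
  have hv : MemLp v 2 (volume.restrict I) := Lp.memLp v
  have hloc : LocallyIntegrableOn v I volume :=
    locallyIntegrableOn_of_locallyIntegrable_restrict (hv.locallyIntegrable (by norm_num))
  have key := hI.ae_eq_zero_of_integral_contDiff_smul_eq_zero hloc ?_
  · rw [Lp.eq_zero_iff_ae_eq_zero]
    filter_upwards [(ae_restrict_iff' hI.measurableSet).2 key] with t ht using ht
  intro ψ h1 h2 h3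
  have hψ : IsTestFunction I ψ := ⟨h1, h2, h3⟩
  have hint : IntegrableOn (fun t => ψ t • v t) I := by
    have hψ2 : MemLp ψ 2 ((volume : Measure ℝ).restrict I) :=
      h1.continuous.memLp_of_hasCompactSupport h2
    exact memLp_one_iff_integrable.1 (MemLp.smul (𝕜 := ℝ) (p := 2) (q := 2) (r := 1) hv hψ2)
  rw [← setIntegral_eq_integral_of_forall_compl_eq_zero (s := I)
    (fun t ht => by rw [image_eq_zero_of_notMem_tsupport (fun h => ht (h3 h)), zero_smul])]
  refine hD.eq_zero_of_inner_right ℂ fun g hg => ?_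
  rw [← integral_inner hint, ← h ψ hψ ⟨g, hg⟩, L2.inner_def]
  refine integral_congr_ae ?_
  filter_upwards [(hψ.memLp g).coeFn_toLp] with t ht
  rw [ht, inner_smul_left, Complex.conj_ofReal, ← Complex.coe_smul, inner_smul_right]

theorem snd_eq_zero_of_mem_closure_preminimalGraph [CompleteSpace H] {I : Set ℝ} (hI : IsOpen I)
    {A : H →ₗ.[ℂ] H} (hA : IsSelfAdjoint A) (p : L2 H I × L2 H I)
    (hp : p ∈ (preminimalGraph I A).topologicalClosure) (h0 : p.1 = 0) : p.2 = 0 := by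
  have hfa : A.IsFormalAdjoint A := by
    have := LinearPMap.adjoint_isFormalAdjoint (T := A) hA.dense_domain
    rwa [LinearPMap.isSelfAdjoint_def.1 hA] at this
  refine eq_zero_of_inner_test_eq_zero hI hA.dense_domain _ fun ψ hψ g => ?_
  rw [inner_of_mem_closure_preminimalGraph hfa hp hψ g, h0, inner_zero_right]

theorem preminimalOperator_graph [CompleteSpace H] {I : Set ℝ} (hI : IsOpen I)
    {A : H →ₗ.[ℂ] H} (hA : IsSelfAdjoint A) :
    (preminimalOperator I A).graph = preminimalGraph I A :=
  Submodule.toLinearPMap_graph_eq _ fun p hp h0 =>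
    snd_eq_zero_of_mem_closure_preminimalGraph hI hA p (Submodule.le_topologicalClosure _ hp) h0

theorem minimalOperator_graph [CompleteSpace H] {I : Set ℝ} (hI : IsOpen I)
    {A : H →ₗ.[ℂ] H} (hA : IsSelfAdjoint A) :
    (minimalOperator I A).graph = (preminimalGraph I A).topologicalClosure := by
  have hc : (preminimalOperator I A).IsClosable :=
    ⟨(preminimalGraph I A).topologicalClosure.toLinearPMap, by
      rw [preminimalOperator_graph hI hA, Submodule.toLinearPMap_graph_eq _
        (snd_eq_zero_of_mem_closure_preminimalGraph hI hA)]⟩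
  rw [minimalOperator, ← hc.graph_closure_eq_closure_graph, preminimalOperator_graph hI hA]

end Minimal

end

end NormalExt

/-!
Let `N` be a normal extension of `L₀` and `N u = z u`. Normality makes `u` an eigenvector of the
adjoint as well: `N* u = conj z u` (`IsFormallyNormal.adjoint_apply_eigenvector`).

Let `e = ψ g` be an elementary tensor in one of the two summands, with `ψ` a test function and
`g ∈ D(A)`. Then `e ∈ D(L₀) ⊆ D(N) ⊆ D(N*)`, and pairing `N* e` with the dense set of finite sums
of such tensors, on which `N` is `d/dt + A`, identifies it: `N* e = -ψ' g + ψ A g`. Pairing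
`N e - N* e = 2 ψ' g` with `u` gives `2 ⟪ψ' g, u⟫ = (conj z - z) ⟪ψ g, u⟫`
(`IsFormallyNormal.inner_sub_eigenvector`). The terms with `A` have cancelled, so each component `v`
of `u` is a weak solution of `v' = i (Im z) v` on its half-line.

Consequently `exp (-i (Im z) t) v` has vanishing weak derivative and is constant by du Bois-Reymond's
lemma. A constant that is square-integrable on a half-line is zero (`eq_zero_of_weak_deriv_eq`), so
both components of `u` vanish.
-/

namespace NormalExt

/-! ### Test functions and weak derivatives on an interval -/

section WeakDerivative

theorem locallyIntegrableOn_coe_L2 {E : Type*} [NormedAddCommGroup E] {I : Set ℝ}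
    (v : L2 E I) : LocallyIntegrableOn v I := by
  have hv : MemLp v 2 (volume.restrict I) := Lp.memLp v
  exact locallyIntegrableOn_of_locallyIntegrable_restrict (hv.locallyIntegrable (by norm_num))

variable {E : Type*} [NormedAddCommGroup E] [NormedSpace ℝ E] {I : Set ℝ}

theorem IsTestFunction.integrable_smul {ψ : ℝ → ℝ} (hψ : IsTestFunction I ψ)
    {k : ℝ → E} (hk : LocallyIntegrableOn k I) : Integrable fun t => ψ t • k t := by
  have h : IntegrableOn (fun t => ψ t • k t) (tsupport ψ) :=
    (hk.integrableOn_compact_subset hψ.tsupport_subset hψ.hasCompactSupport).continuousOn_smul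
      hψ.contDiff.continuous.continuousOn hψ.hasCompactSupport
  refine (integrableOn_iff_integrable_of_support_subset fun t ht => ?_).1 h
  by_contra h'
  exact ht (by simp [image_eq_zero_of_notMem_tsupport h'])

theorem IsTestFunction.deriv {ψ : ℝ → ℝ} (hψ : IsTestFunction I ψ) :
    IsTestFunction I (deriv ψ) :=
  ⟨(contDiff_infty_iff_deriv.1 hψ.contDiff).2, hψ.hasCompactSupport.deriv,
    (closure_minimal support_deriv_subset (isClosed_tsupport ψ)).trans hψ.tsupport_subset⟩

theorem IsTestFunction.mul_contDiff {ψ χ : ℝ → ℝ} (hψ : IsTestFunction I ψ)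
    (hχ : ContDiff ℝ ∞ χ) : IsTestFunction I fun t => ψ t * χ t :=
  ⟨hψ.contDiff.mul hχ, hψ.hasCompactSupport.mul_right,
    (closure_mono (Function.support_mul_subset_left ψ χ)).trans hψ.tsupport_subset⟩

theorem IsTestFunction.sub_const_mul {ψ χ : ℝ → ℝ} (hψ : IsTestFunction I ψ)
    (hχ : IsTestFunction I χ) (c : ℝ) : IsTestFunction I fun t => ψ t - c * χ t := by
  have hs : tsupport (fun t => ψ t - c * χ t) ⊆ tsupport ψ ∪ tsupport χ := by
    refine closure_minimal (fun t ht => ?_) ((isClosed_tsupport ψ).union (isClosed_tsupport χ))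
    by_contra h
    rw [mem_union, not_or] at h
    exact ht (by simp [image_eq_zero_of_notMem_tsupport h.1, image_eq_zero_of_notMem_tsupport h.2])
  exact ⟨hψ.contDiff.sub (contDiff_const.mul hχ.contDiff),
    (hψ.hasCompactSupport.union hχ.hasCompactSupport).of_isClosed_subset
      (isClosed_tsupport _) hs, hs.trans (union_subset hψ.tsupport_subset hχ.tsupport_subset)⟩

/-- On an interval, a test function with vanishing integral is the derivative of a test
function. -/
theorem IsTestFunction.exists_primitive {ψ : ℝ → ℝ} (hψ : IsTestFunction I ψ)
    (hI : I.OrdConnected) (h0 : ∫ t, ψ t = 0) :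
    ∃ φ, IsTestFunction I φ ∧ _root_.deriv φ = ψ := by
  rcases (tsupport ψ).eq_empty_or_nonempty with he | hne
  · rw [tsupport_eq_empty_iff] at he
    refine ⟨0, ⟨contDiff_const, HasCompactSupport.zero, by simp [tsupport]⟩, ?_⟩
    ext t
    simp [he]
  obtain ⟨c, hc⟩ := IsCompact.exists_isLeast hψ.hasCompactSupport hne
  obtain ⟨d, hd⟩ := IsCompact.exists_isGreatest hψ.hasCompactSupport hne
  have hψc := hψ.contDiff.continuous
  have hlt : ∀ t, t < c → ψ t = 0 := fun t ht =>
    image_eq_zero_of_notMem_tsupport fun h => ht.not_ge (hc.2 h)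
  have hgt : ∀ t, d < t → ψ t = 0 := fun t ht =>
    image_eq_zero_of_notMem_tsupport fun h => ht.not_ge (hd.2 h)
  have hder : ∀ t, HasDerivAt (fun t => ∫ x in Iic t, ψ x) (ψ t) t := by
    have hi : Integrable ψ := hψc.integrable_of_hasCompactSupport hψ.hasCompactSupport
    intro t
    have e : (fun t => ∫ x in Iic t, ψ x) = fun t => (∫ x in Iic c, ψ x) + ∫ x in c..t, ψ x := by
      ext t
      rw [← intervalIntegral.integral_Iic_sub_Iic hi.integrableOn hi.integrableOn]
      ring
    rw [e]
    exact (hψc.integral_hasStrictDerivAt c t).hasDerivAt.const_add _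
  have hd' : _root_.deriv (fun t => ∫ x in Iic t, ψ x) = ψ := funext fun t => (hder t).deriv
  have hs : tsupport (fun t => ∫ x in Iic t, ψ x) ⊆ Icc c d := by
    refine closure_minimal (fun t ht => ?_) isClosed_Icc
    by_contra h
    refine ht ?_
    rw [mem_Icc, not_and_or, not_le, not_le] at h
    rcases h with h | h
    · exact setIntegral_eq_zero_of_forall_eq_zero fun x hx => hlt x (lt_of_le_of_lt hx h)
    · change ∫ x in Iic t, ψ x = 0
      rw [← h0]
      exact setIntegral_eq_integral_of_forall_compl_eq_zero fun x hx =>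
        hgt x (h.trans (not_le.1 hx))
  refine ⟨_, ⟨contDiff_infty_iff_deriv.2 ⟨fun t => (hder t).differentiableAt, ?_⟩,
    isCompact_Icc.of_isClosed_subset (isClosed_tsupport _) hs, hs.trans ?_⟩, hd'⟩
  · rw [hd']
    exact hψ.contDiff
  · exact hI.out (hψ.tsupport_subset hc.1) (hψ.tsupport_subset hd.1)

theorem exists_isTestFunction_integral_eq_one (hI : IsOpen I) (hne : I.Nonempty) :
    ∃ ρ, IsTestFunction I ρ ∧ ∫ t, ρ t = 1 := by
  obtain ⟨x, hx⟩ := hne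
  obtain ⟨ε, hε, hb⟩ := Metric.isOpen_iff.1 hI x hx
  let f : ContDiffBump x := ⟨ε / 4, ε / 2, by positivity, by linarith⟩
  refine ⟨f.normed volume, ⟨f.contDiff_normed, f.hasCompactSupport_normed, ?_⟩, f.integral_normed⟩
  rw [f.tsupport_normed_eq]
  exact (Metric.closedBall_subset_ball (by simp only [f]; linarith)).trans hb

/-- Du Bois-Reymond's lemma: a locally integrable function whose weak derivative vanishes on an
open interval is almost everywhere constant there. -/
theorem exists_ae_eq_const_of_integral_deriv_smul_eq_zero [CompleteSpace E] (hI : IsOpen I)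
    (hI' : I.OrdConnected) (hne : I.Nonempty) {k : ℝ → E} (hk : LocallyIntegrableOn k I)
    (h : ∀ φ, IsTestFunction I φ → ∫ t, deriv φ t • k t = 0) :
    ∃ c, k =ᵐ[volume.restrict I] fun _ => c := by
  obtain ⟨ρ, hρ, hρ1⟩ := exists_isTestFunction_integral_eq_one hI hne
  refine ⟨∫ t, ρ t • k t, ?_⟩
  set c := ∫ t, ρ t • k t with hc
  have hloc : LocallyIntegrableOn (fun t => k t - c) I :=
    hk.sub ((locallyIntegrable_const c).locallyIntegrableOn I)
  have key := hI.ae_eq_zero_of_integral_contDiff_smul_eq_zero hloc fun ψ h1 h2 h3 => ?_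
  · filter_upwards [(ae_restrict_iff' hI.measurableSet).2 key] with t ht using sub_eq_zero.1 ht
  have hψ : IsTestFunction I ψ := ⟨h1, h2, h3⟩
  have iψ := h1.continuous.integrable_of_hasCompactSupport h2 (μ := volume)
  have iρ := hρ.contDiff.continuous.integrable_of_hasCompactSupport hρ.hasCompactSupport
    (μ := volume)
  -- subtracting a multiple of `ρ` makes the mean zero, so the difference has a primitive
  obtain ⟨φ, hφ, hφ'⟩ := (hψ.sub_const_mul hρ (∫ t, ψ t)).exists_primitive hI' (by
    rw [integral_sub iψ (iρ.const_mul _), integral_const_mul, hρ1, mul_one, sub_self])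
  have h0 := h φ hφ
  simp only [hφ', sub_smul, mul_smul] at h0
  rw [integral_sub (hψ.integrable_smul hk) ((hρ.integrable_smul hk).fun_smul (∫ t, ψ t)),
    integral_smul, ← hc] at h0
  simp only [smul_sub]
  rw [integral_sub (hψ.integrable_smul hk) (iψ.smul_const c), integral_smul_const, h0]

end WeakDerivative

/-! ### Weak solutions of `v' = i μ v` on an unbounded interval -/

section HalfLine

variable {H : Type*} [NormedAddCommGroup H] [InnerProductSpace ℂ H] [CompleteSpace H] {I : Set ℝ}

theorem IsTestFunction.inner_toLp {ψ : ℝ → ℝ} (hψ : IsTestFunction I ψ) (g : H)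
    (hm : MemLp (fun t => (ψ t : ℂ) • g) 2 ((volume : Measure ℝ).restrict I)) (v : L2 H I) :
    inner ℂ (hm.toLp _) v = inner ℂ g (∫ t, ψ t • v t) := by
  rw [← setIntegral_eq_integral_of_forall_compl_eq_zero (s := I) fun t ht => by
      rw [image_eq_zero_of_notMem_tsupport (fun h => ht (hψ.tsupport_subset h)), zero_smul],
    ← integral_inner (hψ.integrable_smul (locallyIntegrableOn_coe_L2 v)).integrableOn,
    L2.inner_def]
  refine integral_congr_ae ?_
  filter_upwards [hm.coeFn_toLp] with t ht
  rw [ht, inner_smul_left, Complex.conj_ofReal, ← Complex.coe_smul, inner_smul_right]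

/-- A square-integrable weak solution of `v' = i μ v` on an interval of infinite length vanishes:
`exp (-i μ t) v` has vanishing weak derivative, so it is a constant in `L₂`. -/
theorem eq_zero_of_weak_deriv_eq (hI : IsOpen I) (hI' : I.OrdConnected)
    (hvol : volume I = ⊤) {D : Submodule ℂ H} (hD : Dense (D : Set H)) (v : L2 H I) (μ : ℝ)
    (h : ∀ (ψ : ℝ → ℝ) (hψ : IsTestFunction I ψ) (g : D),
      inner ℂ ((hψ.memLp_deriv (g : H)).toLp _) v =
        -(Complex.I * μ) * inner ℂ ((hψ.memLp (g : H)).toLp _) v) : v = 0 := by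
  have hloc := locallyIntegrableOn_coe_L2 v
  have hw : ∀ ψ, IsTestFunction I ψ →
      ∫ t, deriv ψ t • v t = -(Complex.I * μ) • ∫ t, ψ t • v t := fun ψ hψ => by
    refine hD.eq_of_inner_right ℂ fun g hg => ?_
    rw [inner_smul_right, ← hψ.inner_toLp g (hψ.memLp g),
      ← hψ.deriv.inner_toLp g (hψ.memLp_deriv g)]
    exact h ψ hψ ⟨g, hg⟩
  have hcos : ContDiff ℝ ∞ fun t : ℝ => Real.cos (μ * t) := by fun_prop
  have hsin : ContDiff ℝ ∞ fun t : ℝ => Real.sin (μ * t) := by fun_prop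
  let e : ℝ → ℂ := fun t => Real.cos (μ * t) - Complex.I * Real.sin (μ * t)
  have he : Continuous e := by fun_prop
  have henorm : ∀ t, ‖e t‖ = 1 := fun t => by
    have : e t = Complex.exp ((-(μ * t) : ℝ) * Complex.I) := by
      rw [Complex.exp_mul_I, ← Complex.ofReal_cos, ← Complex.ofReal_sin, Real.cos_neg,
        Real.sin_neg]
      simp only [e]
      push_cast
      ring
    rw [this, Complex.norm_exp_ofReal_mul_I]
  have hk : MemLp (fun t => e t • v t) 2 (volume.restrict I) := by
    refine (Lp.memLp v).of_le (he.aestronglyMeasurable.smul (Lp.aestronglyMeasurable v))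
      (Filter.Eventually.of_forall fun t => ?_)
    rw [norm_smul, henorm, one_mul]
  have hkl : LocallyIntegrableOn (fun t => e t • v t) I :=
    locallyIntegrableOn_of_locallyIntegrable_restrict (hk.locallyIntegrable (by norm_num))
  have hne : I.Nonempty := by
    rw [nonempty_iff_ne_empty]
    rintro rfl
    simp at hvol
  -- the real test functions `φ cos (μ t)` and `φ sin (μ t)` stand in for `φ exp (-i μ t)`
  obtain ⟨c, hc⟩ := exists_ae_eq_const_of_integral_deriv_smul_eq_zero hI hI' hne hkl
    fun φ hφ => by
    have h1 := hw _ (hφ.mul_contDiff hcos)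
    have h2 := hw _ (hφ.mul_contDiff hsin)
    have d0 : ∀ t, HasDerivAt φ (deriv φ t) t := fun t =>
      (hφ.contDiff.differentiable (by simp) t).hasDerivAt
    have dm : ∀ t, HasDerivAt (fun t => μ * t) μ t := fun t => by
      simpa using (hasDerivAt_id t).const_mul μ
    have d1 : ∀ t, deriv (fun t => φ t * Real.cos (μ * t)) t =
        deriv φ t * Real.cos (μ * t) - μ * (φ t * Real.sin (μ * t)) := fun t => by
      refine ((d0 t).fun_mul (dm t).cos).deriv.trans ?_
      ring
    have d2 : ∀ t, deriv (fun t => φ t * Real.sin (μ * t)) t =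
        deriv φ t * Real.sin (μ * t) + μ * (φ t * Real.cos (μ * t)) := fun t => by
      refine ((d0 t).fun_mul (dm t).sin).deriv.trans ?_
      ring
    have i1 := (hφ.mul_contDiff hcos).integrable_smul hloc
    have i2 := (hφ.mul_contDiff hsin).integrable_smul hloc
    have i3 := (hφ.deriv.mul_contDiff hcos).integrable_smul hloc
    have i4 := (hφ.deriv.mul_contDiff hsin).integrable_smul hloc
    simp only [d1, sub_smul, mul_smul μ] at h1
    simp only [d2, add_smul, mul_smul μ] at h2
    rw [integral_sub i3 (i2.fun_smul μ), integral_smul] at h1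
    rw [integral_add i4 (i1.fun_smul μ), integral_smul] at h2
    have e0 : ∀ t, deriv φ t • e t • v t = (deriv φ t * Real.cos (μ * t)) • v t -
        Complex.I • (deriv φ t * Real.sin (μ * t)) • v t := fun t => by
      simp only [e, ← Complex.coe_smul, smul_smul, ← sub_smul]
      congr 1
      push_cast
      ring
    simp only [e0]
    rw [integral_sub i3 (i4.fun_smul Complex.I), integral_smul, sub_eq_iff_eq_add.1 h1,
      eq_sub_of_add_eq h2]
    simp only [← Complex.coe_smul]
    match_scalars
    · ring
    · linear_combination (μ : ℂ) * Complex.I_sq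
  have hc0 : c = 0 := by
    have := (memLp_congr_ae hc).1 hk
    rw [memLp_const_iff (by norm_num) (by norm_num)] at this
    simpa [hvol] using this
  rw [Lp.eq_zero_iff_ae_eq_zero]
  filter_upwards [hc] with t ht
  rw [hc0, smul_eq_zero] at ht
  refine ht.resolve_left fun h0 => ?_
  simpa [h0] using henorm t

end HalfLine

/-! ### Eigenvectors of formally normal operators -/

section Abstract

variable {E : Type*} [NormedAddCommGroup E] [InnerProductSpace ℂ E] [CompleteSpace E]
  {N : E →ₗ.[ℂ] E}

theorem IsFormallyNormal.inner_adjoint (hN : IsFormallyNormal N) (f g : N.domain) :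
    inner ℂ (N† ⟨f, hN.domain_le f.2⟩) (g : E) = inner ℂ (f : E) (N g) :=
  N.adjoint_isFormalAdjoint hN.dense_domain ⟨f, hN.domain_le f.2⟩ g

/-- An eigenvector of a formally normal operator is an eigenvector of the adjoint, for the
conjugate eigenvalue: expanding the square gives `‖N* u - conj z u‖ = ‖N u - z u‖`. -/
theorem IsFormallyNormal.adjoint_apply_eigenvector (hN : IsFormallyNormal N) {z : ℂ} {u : N.domain}
    (hu : N u = z • (u : E)) : N† ⟨u, hN.domain_le u.2⟩ = (starRingEnd ℂ z) • (u : E) := by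
  have hi := hN.inner_adjoint u u
  have hn := hN.norm_eq u
  rw [← sub_eq_zero, ← norm_eq_zero, ← sq_eq_zero_iff, @norm_sub_sq ℂ, inner_smul_right, hi, ← hn,
    hu, inner_smul_right, inner_self_eq_norm_sq_to_K, norm_smul, norm_smul, RCLike.norm_conj,
    ← mul_assoc, RCLike.conj_mul]
  norm_cast
  ring

/-- If `N` is formally normal, `N u = z u` and `N* f = f'` can be tested on a total set, then
`⟪N f - f', u⟫ = (conj z - z) ⟪f, u⟫`. -/
theorem IsFormallyNormal.inner_sub_eigenvector (hN : IsFormallyNormal N) {z : ℂ} {u : N.domain}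
    (hu : N u = z • (u : E)) {D : Set N.domain}
    (hD : ∀ x : E, (∀ q ∈ D, inner ℂ (q : E) x = 0) → x = 0) {f : N.domain} {f' : E}
    (hf : ∀ q ∈ D, inner ℂ (N q) (f : E) = inner ℂ (q : E) f') :
    inner ℂ (N f - f') (u : E) = (starRingEnd ℂ z - z) * inner ℂ (f : E) (u : E) := by
  have hadj : N† ⟨f, hN.domain_le f.2⟩ = f' := by
    refine sub_eq_zero.1 (hD _ fun q hq => ?_)
    rw [inner_sub_right, ← hf q hq, ← inner_conj_symm, hN.inner_adjoint f q, inner_conj_symm,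
      sub_self]
  have h1 : inner ℂ f' (u : E) = z * inner ℂ (f : E) (u : E) := by
    rw [← hadj, hN.inner_adjoint f u, hu, inner_smul_right]
  have h2 : inner ℂ (N f) (u : E) = starRingEnd ℂ z * inner ℂ (f : E) (u : E) := by
    rw [← inner_conj_symm, ← hN.inner_adjoint u f, hN.adjoint_apply_eigenvector hu,
      inner_conj_symm, inner_smul_right]
  rw [inner_sub_left, h1, h2, sub_mul]

end Abstract

/-! ### Components of eigenvectors in an embedded `L₂(H, I)` -/

section Components

variable {H : Type*} [NormedAddCommGroup H] [InnerProductSpace ℂ H] {I : Set ℝ}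

theorem IsTestFunction.mem_preminimalGraph {ψ : ℝ → ℝ} (hψ : IsTestFunction I ψ)
    {A : H →ₗ.[ℂ] H} (g : A.domain) :
    ((hψ.memLp (g : H)).toLp _, (hψ.memLp_deriv (g : H)).toLp _ + (hψ.memLp (A g)).toLp _) ∈
      preminimalGraph I A := by
  refine Submodule.subset_span ⟨ψ, hψ, g, (hψ.memLp (g : H)).coeFn_toLp, ?_⟩
  filter_upwards [Lp.coeFn_add ((hψ.memLp_deriv (g : H)).toLp _) ((hψ.memLp (A g)).toLp _),
    (hψ.memLp (A g)).coeFn_toLp, (hψ.memLp_deriv (g : H)).coeFn_toLp] with t h h' h''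
  rw [h, Pi.add_apply, h', h'']

variable {K : Type*} [NormedAddCommGroup K] [InnerProductSpace ℂ K]

/-- The vectors of `D(N)` on which `N` acts, through the embedding `J` of `L₂(H, I)` into a larger
Hilbert space, as `d/dt + A` acts on finite sums of tensors `φ f`. -/
def embeddedTest (N : K →ₗ.[ℂ] K) (J : L2 H I →ₗᵢ[ℂ] K) (A : H →ₗ.[ℂ] H) : Set N.domain :=
  {q | ∃ p ∈ preminimalGraph I A, (q : K) = J p.1 ∧ N q = J p.2}

variable [CompleteSpace H] [CompleteSpace K]

/-- The embedded test vectors are total in the range of `J`. -/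
theorem adjoint_eq_zero_of_inner_embeddedTest (hI : IsOpen I) {A : H →ₗ.[ℂ] H}
    (hA : IsSelfAdjoint A) {N : K →ₗ.[ℂ] K} {J : L2 H I →ₗᵢ[ℂ] K}
    (hJ : ∀ p ∈ preminimalGraph I A, ∃ q : N.domain, (q : K) = J p.1 ∧ N q = J p.2) {x : K}
    (hx : ∀ q ∈ embeddedTest N J A, inner ℂ (q : K) x = 0) :
    J.toContinuousLinearMap.adjoint x = 0 := by
  refine eq_zero_of_inner_test_eq_zero hI hA.dense_domain _ fun ψ hψ g => ?_
  obtain ⟨q, hq, hq'⟩ := hJ _ (hψ.mem_preminimalGraph g)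
  rw [ContinuousLinearMap.adjoint_inner_right, ← hx q ⟨_, hψ.mem_preminimalGraph g, hq, hq'⟩, hq]
  rfl

/-- An eigenvector `u` of a formally normal `N` that acts as `d/dt + A` on the embedded copy of
`L₂(H, I)` has no component there. The component `v` is a weak solution both of `v' + A v = z v`
and of `-v' + A v = conj z v`, and the difference of the two equations is `v' = i (Im z) v`. -/
theorem IsFormallyNormal.adjoint_eigenvector_eq_zero (hI : IsOpen I) (hI' : I.OrdConnected)
    (hvol : volume I = ⊤) {A : H →ₗ.[ℂ] H} (hA : IsSelfAdjoint A) {N : K →ₗ.[ℂ] K}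
    (hN : IsFormallyNormal N) {J : L2 H I →ₗᵢ[ℂ] K}
    (hJ : ∀ p ∈ preminimalGraph I A, ∃ q : N.domain, (q : K) = J p.1 ∧ N q = J p.2)
    {D : Set N.domain} (hD : ∀ x : K, (∀ q ∈ D, inner ℂ (q : K) x = 0) → x = 0)
    (hDJ : ∀ q ∈ D, q ∈ embeddedTest N J A ∨
      ∀ y, inner ℂ (q : K) (J y) = 0 ∧ inner ℂ (N q) (J y) = 0)
    {z : ℂ} {u : N.domain} (hu : N u = z • (u : K)) :
    J.toContinuousLinearMap.adjoint (u : K) = 0 := by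
  have hfa : A.IsFormalAdjoint A := by
    have := LinearPMap.adjoint_isFormalAdjoint (T := A) hA.dense_domain
    rwa [LinearPMap.isSelfAdjoint_def.1 hA] at this
  refine eq_zero_of_weak_deriv_eq hI hI' hvol hA.dense_domain _ z.im fun ψ hψ g => ?_
  obtain ⟨f, hf, hf'⟩ := hJ _ (hψ.mem_preminimalGraph g)
  have key := hN.inner_sub_eigenvector hu hD (f := f)
    (f' := J ((hψ.memLp (A g)).toLp _ - (hψ.memLp_deriv (g : H)).toLp _)) fun q hq => by
    -- the formal adjoint of `d/dt + A` sends `ψ g` to `-ψ' g + ψ A g`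
    rcases hDJ q hq with ⟨p, hp, hq1, hq2⟩ | h
    · rw [hf, hq1, hq2, J.inner_map_map, J.inner_map_map, ← inner_conj_symm,
        inner_of_mem_closure_preminimalGraph hfa (Submodule.le_topologicalClosure _ hp) hψ g,
        inner_conj_symm]
    · rw [hf, (h _).2, (h _).1]
  rw [ContinuousLinearMap.adjoint_inner_right, ContinuousLinearMap.adjoint_inner_right]
  have e : N f - J ((hψ.memLp (A g)).toLp _ - (hψ.memLp_deriv (g : H)).toLp _) =
      (2 : ℂ) • J ((hψ.memLp_deriv (g : H)).toLp _) := by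
    rw [hf', ← map_sub, ← map_smul]
    congr 1
    module
  have hz : starRingEnd ℂ z - z = -(2 * (Complex.I * z.im)) := by
    apply Complex.ext <;> simp
    ring
  rw [e, inner_smul_left, hf, hz, map_ofNat] at key
  simp only [LinearIsometry.coe_toContinuousLinearMap]
  linear_combination key / 2

end Components

/-! ### Hilbert space direct sums -/

section DirectSum

variable {E F : Type*} [NormedAddCommGroup E] [InnerProductSpace ℂ E]
  [NormedAddCommGroup F] [InnerProductSpace ℂ F]

/-- The isometric embedding of the first summand of a Hilbert space direct sum. -/
noncomputable def inlIsometry (E F : Type*) [NormedAddCommGroup E] [InnerProductSpace ℂ E]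
    [NormedAddCommGroup F] [InnerProductSpace ℂ F] : E →ₗᵢ[ℂ] WithLp 2 (E × F) where
  toLinearMap := (WithLp.linearEquiv 2 ℂ (E × F)).symm.toLinearMap ∘ₗ LinearMap.inl ℂ E F
  norm_map' x := by simp

/-- The isometric embedding of the second summand of a Hilbert space direct sum. -/
noncomputable def inrIsometry (E F : Type*) [NormedAddCommGroup E] [InnerProductSpace ℂ E]
    [NormedAddCommGroup F] [InnerProductSpace ℂ F] : F →ₗᵢ[ℂ] WithLp 2 (E × F) where
  toLinearMap := (WithLp.linearEquiv 2 ℂ (E × F)).symm.toLinearMap ∘ₗ LinearMap.inr ℂ E F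
  norm_map' x := by simp

theorem inlIsometry_apply (x : E) : inlIsometry E F x = WithLp.toLp 2 (x, 0) := rfl

theorem inrIsometry_apply (y : F) : inrIsometry E F y = WithLp.toLp 2 (0, y) := rfl

theorem inner_inlIsometry_inrIsometry (x : E) (y : F) :
    inner ℂ (inlIsometry E F x) (inrIsometry E F y) = 0 := by
  simp [inlIsometry_apply, inrIsometry_apply, WithLp.prod_inner_apply]

theorem eq_zero_of_adjoint_eq_zero [CompleteSpace E] [CompleteSpace F] {u : WithLp 2 (E × F)}
    (h₁ : (inlIsometry E F).toContinuousLinearMap.adjoint u = 0)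
    (h₂ : (inrIsometry E F).toContinuousLinearMap.adjoint u = 0) : u = 0 := by
  have e : u = inlIsometry E F u.fst + inrIsometry E F u.snd := by
    rw [inlIsometry_apply, inrIsometry_apply, ← WithLp.toLp_add, Prod.mk_add_mk, add_zero, zero_add]
    rfl
  have i₁ := (inlIsometry E F).toContinuousLinearMap.adjoint_inner_right u.fst u
  have i₂ := (inrIsometry E F).toContinuousLinearMap.adjoint_inner_right u.snd u
  rw [h₁, inner_zero_right] at i₁
  rw [h₂, inner_zero_right] at i₂
  rw [← inner_self_eq_zero (𝕜 := ℂ)]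
  nth_rw 1 [e]
  rw [inner_add_left]
  simpa using congrArg₂ (· + ·) i₁.symm i₂.symm

theorem exists_inlIsometry_of_directSum_le {S : E →ₗ.[ℂ] E} {T : F →ₗ.[ℂ] F}
    {N : WithLp 2 (E × F) →ₗ.[ℂ] WithLp 2 (E × F)} (h : directSum S T ≤ N) {p : E × E}
    (hp : p ∈ S.graph) :
    ∃ q : N.domain, (q : WithLp 2 (E × F)) = inlIsometry E F p.1 ∧ N q = inlIsometry E F p.2 := by
  obtain ⟨x, hx, hx'⟩ := (LinearPMap.mem_graph_iff S).1 hp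
  have hm : WithLp.toLp 2 ((x : E), (0 : F)) ∈ (directSum S T).domain := ⟨x.2, T.domain.zero_mem⟩
  refine ⟨⟨_, h.1 hm⟩, by rw [inlIsometry_apply, ← hx], ?_⟩
  rw [← h.2 (x := ⟨_, hm⟩) rfl, inlIsometry_apply, ← hx']
  exact congrArg (fun y => WithLp.toLp 2 (S x, y)) T.map_zero

theorem exists_inrIsometry_of_directSum_le {S : E →ₗ.[ℂ] E} {T : F →ₗ.[ℂ] F}
    {N : WithLp 2 (E × F) →ₗ.[ℂ] WithLp 2 (E × F)} (h : directSum S T ≤ N) {p : F × F}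
    (hp : p ∈ T.graph) :
    ∃ q : N.domain, (q : WithLp 2 (E × F)) = inrIsometry E F p.1 ∧ N q = inrIsometry E F p.2 := by
  obtain ⟨y, hy, hy'⟩ := (LinearPMap.mem_graph_iff T).1 hp
  have hm : WithLp.toLp 2 ((0 : E), (y : F)) ∈ (directSum S T).domain := ⟨S.domain.zero_mem, y.2⟩
  refine ⟨⟨_, h.1 hm⟩, by rw [inrIsometry_apply, ← hy], ?_⟩
  rw [← h.2 (x := ⟨_, hm⟩) rfl, inrIsometry_apply, ← hy']
  exact congrArg (fun x => WithLp.toLp 2 (x, T y)) S.map_zero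

end DirectSum

end NormalExt

/-- Every normal extension of the minimal operator has empty point spectrum. -/
theorem theorem3p1 {H : Type*} [NormedAddCommGroup H] [InnerProductSpace ℂ H] [CompleteSpace H]
    [TopologicalSpace.SeparableSpace H] (a b : ℝ) (hab : a < b)
    (A₁ A₂ : H →ₗ.[ℂ] H) (hA₁ : IsSelfAdjoint A₁) (hA₂ : IsSelfAdjoint A₂)
    (hA₁_nonpos : NormalExt.Nonpos A₁) (hA₂_nonneg : NormalExt.Nonneg A₂)
    (N : WithLp 2 (NormalExt.L2 H (Iio a) × NormalExt.L2 H (Ioi b)) →ₗ.[ℂ]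
      WithLp 2 (NormalExt.L2 H (Iio a) × NormalExt.L2 H (Ioi b)))
    (hN : NormalExt.IsNormal N) (hext : NormalExt.minimalOperatorSum a b A₁ A₂ ≤ N) :
    NormalExt.pointSpectrum N = ∅ := by
  open NormalExt in
  have hf := hN.toIsFormallyNormal
  have hJ₁ : ∀ p ∈ preminimalGraph (Iio a) A₁, ∃ q : N.domain,
      (q : WithLp 2 (L2 H (Iio a) × L2 H (Ioi b))) = inlIsometry _ _ p.1 ∧
        N q = inlIsometry _ _ p.2 := fun p hp =>
    exists_inlIsometry_of_directSum_le hext <| by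
      rw [minimalOperator_graph isOpen_Iio hA₁]
      exact Submodule.le_topologicalClosure _ hp
  have hJ₂ : ∀ p ∈ preminimalGraph (Ioi b) A₂, ∃ q : N.domain,
      (q : WithLp 2 (L2 H (Iio a) × L2 H (Ioi b))) = inrIsometry _ _ p.1 ∧
        N q = inrIsometry _ _ p.2 := fun p hp =>
    exists_inrIsometry_of_directSum_le hext <| by
      rw [minimalOperator_graph isOpen_Ioi hA₂]
      exact Submodule.le_topologicalClosure _ hp
  have hD : ∀ x, (∀ q ∈ embeddedTest N (inlIsometry _ _) A₁ ∪ embeddedTest N (inrIsometry _ _) A₂,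
      inner ℂ (q : WithLp 2 (L2 H (Iio a) × L2 H (Ioi b))) x = 0) → x = 0 := fun x hx =>
    eq_zero_of_adjoint_eq_zero
      (adjoint_eq_zero_of_inner_embeddedTest isOpen_Iio hA₁ hJ₁ fun q hq => hx q (Or.inl hq))
      (adjoint_eq_zero_of_inner_embeddedTest isOpen_Ioi hA₂ hJ₂ fun q hq => hx q (Or.inr hq))
  refine eq_empty_of_forall_notMem fun z ⟨u, hu0, hu⟩ => hu0 (eq_zero_of_adjoint_eq_zero
    (hf.adjoint_eigenvector_eq_zero isOpen_Iio ordConnected_Iio Real.volume_Iio hA₁ hJ₁ hD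
      (fun q hq => hq.imp_right ?_) hu)
    (hf.adjoint_eigenvector_eq_zero isOpen_Ioi ordConnected_Ioi Real.volume_Ioi hA₂ hJ₂ hD
      (fun q hq => hq.symm.imp_right ?_) hu))
  · rintro ⟨p, -, h1, h2⟩ y
    rw [h1, h2, inner_eq_zero_symm, inner_eq_zero_symm (x := inrIsometry _ _ p.2)]
    exact ⟨inner_inlIsometry_inrIsometry _ _, inner_inlIsometry_inrIsometry _ _⟩
  · rintro ⟨p, -, h1, h2⟩ y
    rw [h1, h2]
    exact ⟨inner_inlIsometry_inrIsometry _ _, inner_inlIsometry_inrIsometry _ _⟩
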